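/- Consider a series of images $y_{i,t,w}$, $1\le t\le T$, where $i$ runs over the $N_I=n_1n_2$ pixels of an $n_1\times n_2$ grid (pixels sharing an edge are neighbours) and $w=1,\dots,N_w$ ($N_w\ge 1$) over energy bands. A *segmentation* $R$ assigns each pixel $i$ a region $R(i)\in\{1,\dots,m\}$, all regions being nonempty and connected; $a_h$ is the number of pixels of region $h$ and $b_h$ the number of pixel edges between region $h$ and other regions. Let $\mathcal M$ be the set of pairs $\psi=(R,\mu)$ with $\mu=(\mu_{h,w})\in\Theta(R)$, where for every $R$ the set $\Theta(R)$ is a given compact set of arrays of positive numbers. Put $l(\psi;Y_t)=\sum_{w}\sum_{i}[\,y_{i,t,w}\log\mu_{R(i),w}-\mu_{R(i),w}]$. Fix $\epsilon>0$ and let $A^K_\epsilon$ be the set of $\nu\in(0,1)^K$ with $\nu_k-\nu_{k-1}>\epsilon$ for $1\le k\le K+1$, where $\nu_0=0$, $\nu_{K+1}=1$. For $\nu\in A_\epsilon^K$ and $\psi=(\psi_1,\dots,\psi_{K+1})\in\mathcal M^{K+1}$, $\psi_k=(R^{(k)},\mu^{(k)})$, let $$\mathrm{MDL}(K,\nu,\psi)=K\log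 T+\sum_{k=1}^{K+1}\Big[m^{(k)}\log N_I+\tfrac{\log 3}{2}\sum_{h}b^{(k)}_h+\tfrac{N_w}{2}\sum_{h}\log\big(([T\nu_k]-[T\nu_{k-1}]+1)\,a^{(k)}_h\big)\Big]-\sum_{k=1}^{K+1}\ \sum_{t=[T\nu_{k-1}]+1}^{[T\nu_k]}l(\psi_k;Y_t).$$ For each $T\ge 1$ let $(\hat K_T,\hat\nu_T,\hat\psi_T)$ almost surely be a minimizer of $\frac1T\mathrm{MDL}(K,\nu,\psi)$ over $K\le[1/\epsilon]+1$, $\nu\in A^K_\epsilon$, $\psi\in\mathcal M^{K+1}$. Let the data follow a true model $(K^o,\nu^o,\psi^o)$ with $\nu^o\in A^{K^o}_\epsilon$ and $\psi^o_k=(R^{o(k)},\mu^{o(k)})\in\mathcal M$: there are independent variables $x^{(k)}_{i,s,w}\sim\mathrm{Poisson}\big(\mu^{o(k)}_{R^{o(k)}(i),w}\big)$ ($1\le k\le K^o+1$, $s\ge1$), not depending on $T$, such that $y_{i,t,w}=x^{(k)}_{i,\,t-[T\nu^o_{k-1}],\,w}$ for $[T\nu^o_{k-1}]<t\le[T\nu^o_k]$.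 Assume that within each true interval neighbouring regions $p\ne q$ satisfy $\mu^{o(k)}_{p,w}\ne\mu^{o(k)}_{q,w}$ for all $w$, and that for any two consecutive true intervals there are a pixel $i$ and a band $w$ with $\mu^{o(k)}_{R^{o(k)}(i),w}\neq\mu^{o(k+1)}_{R^{o(k+1)}(i),w}$. Then: 1. Almost surely, $\hat K_T\ge K^o$ for all sufficiently large $T$. 2. Almost surely, when $\hat K_T>K^o$, the true change points are among the limits of the estimated ones: for every $\delta>0$ and all sufficiently large $T$ with $\hat K_T>K^o$, every $\nu^o_k$, $1\le k\le K^o$, is within $\delta$ of some $\hat\nu_{T,j}$, $1\le j\le\hat K_T$; and whenever along a subsequence $\hat K_{T_n}=K>K^o$ is constant and $\hat\nu_{T_n}\to\nu^*$, one has $\{\nu^o_1,\dots,\nu^o_{K^o}\}\subseteq\{\nu^*_1,\dots,\nu^*_K\}$. 3. Almost surely, for every $\delta>0$ and all sufficiently large $T$, for each fitted interval $j\in\{1,\dots,\hat K_T+1\}$ there is a true interval $k$ such that $\nu^o_{k-1}-\delta<\hat\nu_{T,j-1}$, $\hat\nu_{T,j}<\nu^o_k+\delta$, and $\hat R^{(j)}$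 equals or oversegments $R^{o(k)}$, i.e. $\hat R^{(j)}(i)=\hat R^{(j)}(i')$ implies $R^{o(k)}(i)=R^{o(k)}(i')$ for all pixels $i,i'$. -/

import Mathlib

open MeasureTheory ProbabilityTheory Filter Topology

noncomputable section

/-- The pixels of an `n₁ × n₂` image. -/
abbrev Pixel (n₁ n₂ : ℕ) : Type := Fin n₁ × Fin n₂

/-- Neighbouring pixels of the image: two pixels are adjacent iff they share an edge. -/
def pixelGraph (n₁ n₂ : ℕ) : SimpleGraph (Pixel n₁ n₂) :=
  SimpleGraph.boxProd (SimpleGraph.pathGraph n₁) (SimpleGraph.pathGraph n₂)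

/-- A segmentation of the image into `m` regions, given by its region assignment function.
Every region is connected; in particular (`SimpleGraph.Connected` contains it) it is nonempty. -/
structure Segmentation (n₁ n₂ : ℕ) where
  m : ℕ
  label : Pixel n₁ n₂ → Fin m
  connected : ∀ h : Fin m, ((pixelGraph n₁ n₂).induce {i | label i = h}).Connected

/-- The area (number of pixels) of region `h`. -/
def Segmentation.area {n₁ n₂ : ℕ} (R : Segmentation n₁ n₂) (h : Fin R.m) : ℕ :=
  (Finset.univ.filter fun i : Pixel n₁ n₂ => R.label i = h).card

open Classical in
/-- The perimeter of region `h`: the number of pixel edges between it and neighbouring regions. -/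
def Segmentation.perimeter {n₁ n₂ : ℕ} (R : Segmentation n₁ n₂) (h : Fin R.m) : ℕ :=
  (Finset.univ.filter fun e : Pixel n₁ n₂ × Pixel n₁ n₂ =>
    (pixelGraph n₁ n₂).Adj e.1 e.2 ∧ R.label e.1 = h ∧ R.label e.2 ≠ h).card

/-- `Rb` is equal to, or an oversegmentation of, `Rs`. -/
def Oversegments {n₁ n₂ : ℕ} (Rb Rs : Segmentation n₁ n₂) : Prop :=
  ∀ i j : Pixel n₁ n₂, Rb.label i = Rb.label j → Rs.label i = Rs.label j

/-- The parameter `(R, μ)` of one time interval: a segmentation, and a Poisson rate for each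
region and each of the `nw` energy bands. -/
structure RegionModel (n₁ n₂ nw : ℕ) where
  seg : Segmentation n₁ n₂
  rate : Fin seg.m → Fin nw → ℝ

/-- The Poisson rate of pixel `i` in band `w`. -/
def RegionModel.intensity {n₁ n₂ nw : ℕ} (ψ : RegionModel n₁ n₂ nw)
    (i : Pixel n₁ n₂) (w : Fin nw) : ℝ :=
  ψ.rate (ψ.seg.label i) w

/-- The Poisson log-likelihood of one image `y`, without the term that is free of parameters. -/
def RegionModel.logLik {n₁ n₂ nw : ℕ} (ψ : RegionModel n₁ n₂ nw)
    (y : Pixel n₁ n₂ → Fin nw → ℕ) : ℝ :=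
  ∑ w : Fin nw, ∑ h : Fin ψ.seg.m,
    ∑ i ∈ Finset.univ.filter (fun i : Pixel n₁ n₂ => ψ.seg.label i = h),
      ((y i w : ℝ) * Real.log (ψ.rate h w) - ψ.rate h w)

/-- A model `(K, ν, ψ)` for the series of images. The normalized change points are
`ν 1, …, ν K`; the entries `ν 0` and `ν (K + 1)` are the end points `0` and `1`
(see `SeriesModel.Admissible`). The `k`-th interval runs from `ν k.castSucc` to `ν k.succ`. -/
structure SeriesModel (n₁ n₂ nw : ℕ) where
  K : ℕ
  ν : Fin (K + 2) → ℝ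
  ψ : Fin (K + 1) → RegionModel n₁ n₂ nw

/-- The `K` normalized change points proper, without the end points `0` and `1`. -/
def SeriesModel.changePoint {n₁ n₂ nw : ℕ} (M : SeriesModel n₁ n₂ nw) (k : Fin M.K) : ℝ :=
  M.ν k.succ.castSucc

/-- The change points `[T ν_k]` on the time scale `0, …, T`. -/
def SeriesModel.tau {n₁ n₂ nw : ℕ} (M : SeriesModel n₁ n₂ nw) (T : ℕ)
    (k : Fin (M.K + 2)) : ℕ :=
  ⌊(T : ℝ) * M.ν k⌋₊

/-- The MDL criterion of the model `M` for the images `y 1, …, y T`. -/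
def SeriesModel.mdl {n₁ n₂ nw : ℕ} (M : SeriesModel n₁ n₂ nw) (T : ℕ)
    (y : ℕ → Pixel n₁ n₂ → Fin nw → ℕ) : ℝ :=
  (M.K : ℝ) * Real.log (T : ℝ)
  + ∑ k : Fin (M.K + 1),
      (((M.ψ k).seg.m : ℝ) * Real.log ((n₁ * n₂ : ℕ) : ℝ)
        + Real.log 3 / 2 * ∑ h : Fin (M.ψ k).seg.m, ((M.ψ k).seg.perimeter h : ℝ)
        + (nw : ℝ) / 2 * ∑ h : Fin (M.ψ k).seg.m,
            Real.log (((M.tau T k.succ : ℝ) - (M.tau T k.castSucc : ℝ) + 1)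
              * ((M.ψ k).seg.area h : ℝ)))
  - ∑ k : Fin (M.K + 1), ∑ t ∈ Finset.Ioc (M.tau T k.castSucc) (M.tau T k.succ),
      (M.ψ k).logLik (y t)

/-- The models over which the criterion is minimized: at most `[1/ε] + 1` change points,
consecutive normalized change points more than `ε` apart, and in every interval a pair `(R, μ)`
with `μ` in the parameter space `Θ R`. -/
def SeriesModel.Admissible {n₁ n₂ nw : ℕ} (ε : ℝ)
    (Θ : (R : Segmentation n₁ n₂) → Set (Fin R.m → Fin nw → ℝ))
    (M : SeriesModel n₁ n₂ nw) : Prop :=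
  M.K ≤ ⌊1 / ε⌋₊ + 1 ∧
  M.ν 0 = 0 ∧ M.ν (Fin.last (M.K + 1)) = 1 ∧
  (∀ k : Fin (M.K + 1), ε < M.ν k.succ - M.ν k.castSucc) ∧
  (∀ k : Fin (M.K + 1), (M.ψ k).rate ∈ Θ (M.ψ k).seg)

/-- `M` is an MDL estimate from the images `y 1, …, y T`: it minimizes `MDL / T` over all
admissible models. -/
def IsMDLEstimate {n₁ n₂ nw : ℕ} (ε : ℝ)
    (Θ : (R : Segmentation n₁ n₂) → Set (Fin R.m → Fin nw → ℝ)) (T : ℕ)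
    (y : ℕ → Pixel n₁ n₂ → Fin nw → ℕ) (M : SeriesModel n₁ n₂ nw) : Prop :=
  M.Admissible ε Θ ∧
  ∀ M' : SeriesModel n₁ n₂ nw, M'.Admissible ε Θ →
    1 / (T : ℝ) * M.mdl T y ≤ 1 / (T : ℝ) * M'.mdl T y

/-- The image at time `t` in a series of length `T` with change points `[T ν_k]`: inside the
`k`-th interval it is the image number `t - [T ν_(k-1)]` of the `k`-th sequence `x k`. -/
def SeriesModel.observed {n₁ n₂ nw : ℕ} (M : SeriesModel n₁ n₂ nw)
    (x : Fin (M.K + 1) → ℕ → Pixel n₁ n₂ → Fin nw → ℕ) (T : ℕ) (t : ℕ)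
    (i : Pixel n₁ n₂) (w : Fin nw) : ℕ :=
  ∑ k : Fin (M.K + 1),
    if M.tau T k.castSucc < t ∧ t ≤ M.tau T k.succ then x k (t - M.tau T k.castSucc) i w else 0

end

/-! ### The Poisson distribution and the law of large numbers -/

/-! By the strong law, almost surely all averages of the counts converge to their rates. Everything
after that is deterministic and holds for all minimizers at once. Compare a minimizer with the true
model on the common refinement of their intervals. On each cell the log-likelihood lost by the fit
is (number of times) × (Poisson divergence) plus noise. The noise is linear in the deviations of the
counts, with coefficients that are differences of log rates. These are bounded by compactness, and
the deviations are `o(T)` uniformly over windows, so the noise is `o(T)` uniformly over all models.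
The penalty of the minimizer is nonnegative and that of the true model is `o(T)`, so every product
of cell size and divergence is at most `η T` (`eventually_card_cell_mul_div_le`). Hence a fitted
model has small divergence from every true one it overlaps substantially
(`eventually_div_le_of_overlap`). By compactness and finiteness of the set of segmentations,
divergences are bounded below where a fit must serve two different consecutive true models, or does
not oversegment the true regions. So fitted intervals do not straddle true change points, and their
segmentations are fine enough. -/

lemma hasSum_mul_poissonMeasure (r : NNReal) :
    HasSum (fun n : ℕ => (Real.exp (-r) * r ^ n / (n.factorial : ℝ)) * (n : ℝ)) r := by
  -- Dropping the zero term and shifting the index turns the mean into `r` times the total mass.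
  rw [← hasSum_nat_add_iff' 1]
  have h := (hasSum_one_poissonMeasure r).mul_left (r : ℝ)
  simp only [Finset.range_one, Finset.sum_singleton, Nat.cast_zero, mul_zero, sub_zero]
  rw [mul_one] at h
  refine h.congr_fun ?_
  intro n
  rw [Nat.factorial_succ]
  push_cast
  have : (n.factorial : ℝ) ≠ 0 := by positivity
  field_simp
  ring

lemma integrable_natCast_poissonMeasure (r : NNReal) :
    Integrable (fun n : ℕ => (n : ℝ)) (poissonMeasure r) := by
  rw [integrable_poissonMeasure_iff]
  simpa using (hasSum_mul_poissonMeasure r).summable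

lemma integral_natCast_poissonMeasure (r : NNReal) :
    ∫ n : ℕ, (n : ℝ) ∂(poissonMeasure r) = r := by
  rw [integral_poissonMeasure' (integrable_natCast_poissonMeasure r)]
  simpa using (hasSum_mul_poissonMeasure r).tsum_eq

lemma ae_tendsto_average_poisson {Ω : Type*} [MeasurableSpace Ω] {P : Measure Ω}
    {Y : ℕ → Ω → ℕ} {r : NNReal}
    (hlaw : ∀ s, HasLaw (Y s) (poissonMeasure r) P)
    (hindep : Pairwise fun s t => IndepFun (Y s) (Y t) P) :
    ∀ᵐ ω ∂P, Tendsto (fun n : ℕ => (∑ s ∈ Finset.range n, (Y s ω : ℝ)) / n) atTop (𝓝 r) := by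
  have hm : Measurable (fun n : ℕ => (n : ℝ)) := measurable_from_top
  have hint : Integrable (fun ω => (Y 0 ω : ℝ)) P := by
    have := (hlaw 0).map_eq ▸ integrable_natCast_poissonMeasure r
    exact this.comp_aemeasurable (hlaw 0).aemeasurable
  have hmean : ∫ ω, (Y 0 ω : ℝ) ∂P = r := by
    rw [← integral_natCast_poissonMeasure r, ← (hlaw 0).map_eq,
      integral_map (hlaw 0).aemeasurable hm.aestronglyMeasurable]
  rw [← hmean]
  refine strong_law_ae_real (fun s ω => (Y s ω : ℝ)) hint
    (fun s t hst => (hindep hst).comp hm hm) fun s => ?_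
  exact IdentDistrib.comp ⟨(hlaw s).aemeasurable, (hlaw 0).aemeasurable,
    (hlaw s).map_eq.trans (hlaw 0).map_eq.symm⟩ hm

/-- The constant `C` absorbs the finitely many early indices, so the bound also covers short partial
sums, as needed for arbitrarily placed windows. -/
lemma exists_abs_sub_le_of_tendsto_div {u : ℕ → ℝ} {c : ℝ}
    (h : Tendsto (fun n : ℕ => u n / n) atTop (𝓝 c)) {η : ℝ} (hη : 0 < η) :
    ∃ C, 0 ≤ C ∧ ∀ n : ℕ, |u n - n * c| ≤ η * n + C := by
  obtain ⟨N, hN⟩ := eventually_atTop.1 (Metric.tendsto_nhds.1 h η hη)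
  refine ⟨∑ n ∈ Finset.range (N + 1), |u n - n * c|,
    Finset.sum_nonneg fun _ _ => abs_nonneg _, fun n => ?_⟩
  have h0 : 0 ≤ ∑ n ∈ Finset.range (N + 1), |u n - n * c| :=
    Finset.sum_nonneg fun _ _ => abs_nonneg _
  rcases le_or_gt n N with hn | hn
  · have := Finset.single_le_sum (f := fun n : ℕ => |u n - n * c|) (fun _ _ => abs_nonneg _)
      (Finset.mem_range.2 (Nat.lt_succ_of_le hn))
    have : 0 ≤ η * n := by positivity
    linarith
  · have hpos : (0 : ℝ) < n := by exact_mod_cast (Nat.zero_le N).trans_lt hn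
    have := hN n hn.le
    rw [Real.dist_eq] at this
    have e : u n - n * c = (u n / n - c) * n := by field_simp
    rw [e, abs_mul, abs_of_pos hpos]
    nlinarith

/-! ### The Poisson divergence -/

noncomputable section

/-- The Kullback-Leibler divergence between the Poisson distributions of rates `a` and `b`. -/
def poissonDiv (a b : ℝ) : ℝ := a * (Real.log a - Real.log b) - (a - b)

/-- This form transfers nonnegativity and the equality case from `klFun`. -/
lemma poissonDiv_eq_klFun {a b : ℝ} (ha : 0 < a) (hb : 0 < b) :
    poissonDiv a b = b * InformationTheory.klFun (a / b) := by
  rw [poissonDiv, InformationTheory.klFun_apply, Real.log_div ha.ne' hb.ne']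
  field_simp
  ring

lemma poissonDiv_nonneg {a b : ℝ} (ha : 0 < a) (hb : 0 < b) : 0 ≤ poissonDiv a b := by
  rw [poissonDiv_eq_klFun ha hb]
  exact mul_nonneg hb.le (InformationTheory.klFun_nonneg (div_pos ha hb).le)

lemma poissonDiv_eq_zero_iff {a b : ℝ} (ha : 0 < a) (hb : 0 < b) :
    poissonDiv a b = 0 ↔ a = b := by
  rw [poissonDiv_eq_klFun ha hb, mul_eq_zero, or_iff_right hb.ne',
    InformationTheory.klFun_eq_zero_iff (div_pos ha hb).le, div_eq_one_iff_eq hb.ne']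

variable {n₁ n₂ nw : ℕ}

/-- The divergence between the laws of one image under two region models. -/
def RegionModel.div (ψo ψ : RegionModel n₁ n₂ nw) : ℝ :=
  ∑ i, ∑ w, poissonDiv (ψo.intensity i w) (ψ.intensity i w)

lemma RegionModel.div_nonneg {ψo ψ : RegionModel n₁ n₂ nw}
    (ho : ∀ i w, 0 < ψo.intensity i w) (h : ∀ i w, 0 < ψ.intensity i w) : 0 ≤ ψo.div ψ :=
  Finset.sum_nonneg fun i _ => Finset.sum_nonneg fun w _ => poissonDiv_nonneg (ho i w) (h i w)

lemma RegionModel.intensity_eq_of_div_eq_zero {ψo ψ : RegionModel n₁ n₂ nw}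
    (ho : ∀ i w, 0 < ψo.intensity i w) (h : ∀ i w, 0 < ψ.intensity i w)
    (h0 : ψo.div ψ = 0) (i : Pixel n₁ n₂) (w : Fin nw) :
    ψo.intensity i w = ψ.intensity i w := by
  have h1 := (Finset.sum_eq_zero_iff_of_nonneg fun i _ =>
    Finset.sum_nonneg fun w _ => poissonDiv_nonneg (ho i w) (h i w)).1 h0 i (Finset.mem_univ _)
  have h2 := (Finset.sum_eq_zero_iff_of_nonneg fun w _ =>
    poissonDiv_nonneg (ho i w) (h i w)).1 h1 w (Finset.mem_univ _)
  exact (poissonDiv_eq_zero_iff (ho i w) (h i w)).1 h2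

/-- Written pixel by pixel, likelihoods of models with different segmentations become comparable. -/
lemma RegionModel.logLik_eq_sum (ψ : RegionModel n₁ n₂ nw) (y : Pixel n₁ n₂ → Fin nw → ℕ) :
    ψ.logLik y = ∑ i, ∑ w, ((y i w : ℝ) * Real.log (ψ.intensity i w) - ψ.intensity i w) := by
  rw [RegionModel.logLik, Finset.sum_comm (s := Finset.univ (α := Pixel n₁ n₂))]
  refine Finset.sum_congr rfl fun w _ => ?_
  rw [← Finset.sum_fiberwise Finset.univ ψ.seg.label]
  refine Finset.sum_congr rfl fun h _ => Finset.sum_congr rfl fun i hi => ?_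
  rw [RegionModel.intensity, (Finset.mem_filter.1 hi).2]

/-! ### Compactness of the parameter space -/

lemma Segmentation.label_surjective (R : Segmentation n₁ n₂) :
    Function.Surjective R.label := fun h =>
  let ⟨i, hi⟩ := (R.connected h).nonempty
  ⟨i, hi⟩

/-- Regions are nonempty, so there are at most as many as pixels. Finiteness lets bounds on each
compact `Θ R` be merged into one. -/
instance Segmentation.instFinite : Finite (Segmentation n₁ n₂) := by
  have hm (R : Segmentation n₁ n₂) : R.m < Fintype.card (Pixel n₁ n₂) + 1 := by
    simpa [Nat.lt_succ_iff] using Fintype.card_le_of_surjective _ R.label_surjective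
  refine Finite.of_injective (β := Σ m : Fin (Fintype.card (Pixel n₁ n₂) + 1),
    Pixel n₁ n₂ → Fin m) (fun R => ⟨⟨R.m, hm R⟩, R.label⟩) ?_
  rintro ⟨m, l, c⟩ ⟨m', l', c'⟩ h
  simp only [Sigma.mk.injEq, Fin.mk.injEq] at h
  obtain ⟨rfl, h⟩ := h
  obtain rfl := eq_of_heq h
  rfl

variable {Θ : (R : Segmentation n₁ n₂) → Set (Fin R.m → Fin nw → ℝ)}

lemma continuousOn_log_rate (hΘ_pos : ∀ R, ∀ μ ∈ Θ R, ∀ h w, 0 < μ h w)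
    (R : Segmentation n₁ n₂) (h : Fin R.m) (w : Fin nw) :
    ContinuousOn (fun μ : Fin R.m → Fin nw → ℝ => Real.log (μ h w)) (Θ R) :=
  ContinuousOn.log (by fun_prop) fun μ hμ => (hΘ_pos R μ hμ h w).ne'

lemma RegionModel.continuousOn_div (hΘ_pos : ∀ R, ∀ μ ∈ Θ R, ∀ h w, 0 < μ h w)
    (ψo : RegionModel n₁ n₂ nw) (R : Segmentation n₁ n₂) :
    ContinuousOn (fun μ : Fin R.m → Fin nw → ℝ => ψo.div ⟨R, μ⟩) (Θ R) := by
  refine continuousOn_finsetSum _ fun i _ => continuousOn_finsetSum _ fun w _ => ?_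
  have h1 := continuousOn_log_rate hΘ_pos R (R.label i) w
  have h2 : ContinuousOn (fun μ : Fin R.m → Fin nw → ℝ => μ (R.label i) w) (Θ R) := by fun_prop
  exact (continuousOn_const.mul (continuousOn_const.sub h1)).sub (continuousOn_const.sub h2)

lemma exists_abs_log_intensity_le (hΘ_compact : ∀ R, IsCompact (Θ R))
    (hΘ_pos : ∀ R, ∀ μ ∈ Θ R, ∀ h w, 0 < μ h w) :
    ∃ B, 0 ≤ B ∧ ∀ ψ : RegionModel n₁ n₂ nw, ψ.rate ∈ Θ ψ.seg →
      ∀ i w, |Real.log (ψ.intensity i w)| ≤ B := by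
  have h (p : Σ R : Segmentation n₁ n₂, Fin R.m × Fin nw) : ∃ B : ℝ, ∀ μ ∈ Θ p.1,
      |Real.log (μ p.2.1 p.2.2)| ≤ B :=
    (hΘ_compact p.1).exists_bound_of_continuousOn (continuousOn_log_rate hΘ_pos p.1 p.2.1 p.2.2)
  choose B hB using h
  obtain ⟨C, hC⟩ := (Set.finite_range B).bddAbove
  refine ⟨max C 0, le_max_right _ _, fun ψ hψ i w => ?_⟩
  exact ((hB ⟨ψ.seg, ψ.seg.label i, w⟩ _ hψ).trans (hC ⟨_, rfl⟩)).trans (le_max_left _ _)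

/-- A function that is continuous in the rates and positive on the models with a property of their
segmentations is bounded away from `0` on these. -/
lemma exists_pos_le_of_continuousOn (hΘ_compact : ∀ R, IsCompact (Θ R))
    (Q : Segmentation n₁ n₂ → Prop) (f : RegionModel n₁ n₂ nw → ℝ)
    (hf : ∀ R, ContinuousOn (fun μ => f ⟨R, μ⟩) (Θ R))
    (hpos : ∀ R, Q R → ∀ μ ∈ Θ R, 0 < f ⟨R, μ⟩) :
    ∃ c, 0 < c ∧ ∀ ψ : RegionModel n₁ n₂ nw, ψ.rate ∈ Θ ψ.seg → Q ψ.seg → c ≤ f ψ := by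
  have h (R : Segmentation n₁ n₂) : ∃ c, 0 < c ∧ (Q R → ∀ μ ∈ Θ R, c ≤ f ⟨R, μ⟩) := by
    by_cases hQ : Q R
    · rcases (Θ R).eq_empty_or_nonempty with he | hne
      · exact ⟨1, one_pos, fun _ μ hμ => by simp [he] at hμ⟩
      · obtain ⟨μ₀, hμ₀, hmin⟩ := (hΘ_compact R).exists_isMinOn hne (hf R)
        exact ⟨f ⟨R, μ₀⟩, hpos R hQ μ₀ hμ₀, fun _ μ hμ => hmin hμ⟩
    · exact ⟨1, one_pos, fun h => absurd h hQ⟩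
  choose c hc0 hc using h
  rcases isEmpty_or_nonempty (Segmentation n₁ n₂) with hE | hN
  · exact ⟨1, one_pos, fun ψ _ _ => (hE.false ψ.seg).elim⟩
  · obtain ⟨R₀, hR₀⟩ := Finite.exists_min c
    exact ⟨c R₀, hc0 R₀, fun ψ hψ hQ => (hR₀ _).trans (hc ψ.seg hQ _ hψ)⟩

/-- Vanishing divergence determines the intensities, so no single model is at divergence zero from
both; compactness makes this quantitative. -/
lemma exists_pos_le_div_add_div (hΘ_compact : ∀ R, IsCompact (Θ R))
    (hΘ_pos : ∀ R, ∀ μ ∈ Θ R, ∀ h w, 0 < μ h w) {ψ₁ ψ₂ : RegionModel n₁ n₂ nw}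
    (h₁ : ∀ i w, 0 < ψ₁.intensity i w) (h₂ : ∀ i w, 0 < ψ₂.intensity i w)
    {i : Pixel n₁ n₂} {w : Fin nw} (hne : ψ₁.intensity i w ≠ ψ₂.intensity i w) :
    ∃ c, 0 < c ∧ ∀ ψ : RegionModel n₁ n₂ nw, ψ.rate ∈ Θ ψ.seg → c ≤ ψ₁.div ψ + ψ₂.div ψ := by
  have key (R : Segmentation n₁ n₂) (μ : Fin R.m → Fin nw → ℝ) (hμ : μ ∈ Θ R) :
      0 < ψ₁.div ⟨R, μ⟩ + ψ₂.div ⟨R, μ⟩ := by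
    have hpos : ∀ i w, 0 < (RegionModel.mk R μ).intensity i w := fun i w => hΘ_pos R μ hμ _ w
    have d₁ := RegionModel.div_nonneg h₁ hpos
    have d₂ := RegionModel.div_nonneg h₂ hpos
    refine (add_nonneg d₁ d₂).lt_of_ne fun h0 => hne ?_
    rw [RegionModel.intensity_eq_of_div_eq_zero h₁ hpos (by linarith) i w,
      RegionModel.intensity_eq_of_div_eq_zero h₂ hpos (by linarith) i w]
  obtain ⟨c, hc, h⟩ := exists_pos_le_of_continuousOn hΘ_compact (fun _ => True)
    (fun ψ => ψ₁.div ψ + ψ₂.div ψ)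
    (fun R => (RegionModel.continuousOn_div hΘ_pos ψ₁ R).add
      (RegionModel.continuousOn_div hΘ_pos ψ₂ R)) fun R _ => key R
  exact ⟨c, hc, fun ψ hψ => h ψ hψ trivial⟩

/-- Regions are connected, so a segmentation along which the intensity of `ψ` is constant
oversegments that of `ψ`, if neighbouring regions of `ψ` have different rates. -/
lemma oversegments_of_intensity_eq (R : Segmentation n₁ n₂) (ψ : RegionModel n₁ n₂ nw) (w : Fin nw)
    (hne : ∀ i j : Pixel n₁ n₂, (pixelGraph n₁ n₂).Adj i j →
      ψ.seg.label i ≠ ψ.seg.label j → ψ.intensity i w ≠ ψ.intensity j w)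
    (heq : ∀ i j, R.label i = R.label j → ψ.intensity i w = ψ.intensity j w) :
    Oversegments R ψ.seg := by
  intro i j hij
  have hr := (R.connected (R.label j)).preconnected ⟨i, hij⟩ ⟨j, rfl⟩
  rw [SimpleGraph.reachable_iff_reflTransGen] at hr
  suffices ∀ a : {i | R.label i = R.label j}, Relation.ReflTransGen
      ((pixelGraph n₁ n₂).induce {i | R.label i = R.label j}).Adj ⟨i, hij⟩ a →
      ψ.seg.label i = ψ.seg.label a from this _ hr
  intro a ha
  induction ha with
  | refl => rfl
  | @tail b c _ hbc ih =>
    rw [ih]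
    by_contra hl
    exact hne b c hbc hl (heq b c (b.2.trans c.2.symm))

/-- At divergence zero the true intensity would be constant on each fitted region, which forces
oversegmentation by connectedness. -/
lemma exists_pos_le_div_of_not_oversegments (hΘ_compact : ∀ R, IsCompact (Θ R))
    (hΘ_pos : ∀ R, ∀ μ ∈ Θ R, ∀ h w, 0 < μ h w) {ψo : RegionModel n₁ n₂ nw}
    (ho : ∀ i w, 0 < ψo.intensity i w) (w : Fin nw)
    (hne : ∀ i j : Pixel n₁ n₂, (pixelGraph n₁ n₂).Adj i j →
      ψo.seg.label i ≠ ψo.seg.label j → ψo.intensity i w ≠ ψo.intensity j w) :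
    ∃ c, 0 < c ∧ ∀ ψ : RegionModel n₁ n₂ nw, ψ.rate ∈ Θ ψ.seg →
      ¬ Oversegments ψ.seg ψo.seg → c ≤ ψo.div ψ := by
  refine exists_pos_le_of_continuousOn hΘ_compact (fun R => ¬ Oversegments R ψo.seg)
    (fun ψ => ψo.div ψ) (RegionModel.continuousOn_div hΘ_pos ψo) fun R hR μ hμ => ?_
  have hpos : ∀ i w, 0 < (RegionModel.mk R μ).intensity i w := fun i w => hΘ_pos R μ hμ _ w
  refine (RegionModel.div_nonneg ho hpos).lt_of_ne fun h0 => hR ?_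
  refine oversegments_of_intensity_eq R ψo w hne fun i j hij => ?_
  rw [RegionModel.intensity_eq_of_div_eq_zero ho hpos h0.symm,
    RegionModel.intensity_eq_of_div_eq_zero ho hpos h0.symm]
  simp [RegionModel.intensity, hij]

end

/-! ### Partitions into consecutive intervals -/

lemma exists_castSucc_lt_le_succ {α : Type*} [LinearOrder α] {n : ℕ} (τ : Fin (n + 2) → α) {t : α}
    (h0 : τ 0 < t) (h1 : t ≤ τ (Fin.last (n + 1))) :
    ∃ k : Fin (n + 1), τ k.castSucc < t ∧ t ≤ τ k.succ := by
  by_contra! h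
  have : ∀ k : Fin (n + 2), τ k < t := fun k => Fin.induction h0 (fun i hi => h i hi) k
  exact (this (Fin.last _)).not_ge h1

lemma eq_of_castSucc_lt_le_succ {α : Type*} [LinearOrder α] {n : ℕ} {τ : Fin (n + 2) → α}
    (hτ : Monotone τ) {t : α} {k l : Fin (n + 1)} (hk : τ k.castSucc < t) (hk' : t ≤ τ k.succ)
    (hl : τ l.castSucc < t) (hl' : t ≤ τ l.succ) : k = l := by
  have key {p q : Fin (n + 1)} (hp : t ≤ τ p.succ) (hq : τ q.castSucc < t) : q ≤ p := by
    by_contra! hpq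
    exact (hq.trans_le hp).not_ge (hτ (Fin.succ_le_castSucc_iff.2 hpq))
  exact le_antisymm (key hl' hk) (key hk' hl)

/-- Each time in a `τ`-interval lies in exactly one `σ`-interval. -/
lemma sum_sum_Ioc_inter {n m : ℕ} {τ : Fin (n + 2) → ℕ} {σ : Fin (m + 2) → ℕ}
    (hτ : Monotone τ) (hσ : Monotone σ) (h0 : σ 0 ≤ τ 0)
    (h1 : τ (Fin.last _) ≤ σ (Fin.last _)) (f : Fin (n + 1) → ℕ → ℝ) :
    ∑ j, ∑ t ∈ Finset.Ioc (τ j.castSucc) (τ j.succ), f j t =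
      ∑ j, ∑ k : Fin (m + 1), ∑ t ∈ Finset.Ioc (τ j.castSucc) (τ j.succ) ∩
        Finset.Ioc (σ k.castSucc) (σ k.succ), f j t := by
  refine Finset.sum_congr rfl fun j _ => ?_
  simp_rw [← Finset.sum_ite_mem]
  rw [Finset.sum_comm]
  refine Finset.sum_congr rfl fun t ht => ?_
  rw [Finset.mem_Ioc] at ht
  obtain ⟨k, hk, hk'⟩ := exists_castSucc_lt_le_succ σ
    ((h0.trans (hτ (Fin.zero_le _))).trans_lt ht.1) ((ht.2.trans (hτ (Fin.le_last _))).trans h1)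
  rw [Finset.sum_eq_single k, if_pos (Finset.mem_Ioc.2 ⟨hk, hk'⟩)]
  · intro l _ hl
    refine if_neg fun h => hl ?_
    rw [Finset.mem_Ioc] at h
    exact eq_of_castSucc_lt_le_succ hσ h.1 h.2 hk hk'
  · simp

lemma sum_Ioc_shift (g : ℕ → ℝ) {p q c : ℕ} (hc : c ≤ p) (hpq : p ≤ q) :
    ∑ t ∈ Finset.Ioc p q, g (t - c) =
      ∑ s ∈ Finset.range (q - c), g (s + 1) - ∑ s ∈ Finset.range (p - c), g (s + 1) := by
  induction q, hpq using Nat.le_induction with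
  | base => simp
  | succ q hq ih =>
    rw [Finset.sum_Ioc_succ_top hq, ih, show q + 1 - c = q - c + 1 by omega,
      Finset.sum_range_succ]
    ring

/-- A window sum is a difference of two partial sums, whence the factor `2`. The bound does not
depend on `a` and `b`, so it is uniform over fitted intervals. -/
lemma abs_sum_Ioc_inter_sub_le {g : ℕ → ℝ} {r η C : ℝ} (hη : 0 ≤ η) (hC : 0 ≤ C)
    (hg : ∀ n : ℕ, |∑ s ∈ Finset.range n, g (s + 1) - n * r| ≤ η * n + C)
    {a b c d T : ℕ} (hd : d ≤ T) :
    |∑ t ∈ Finset.Ioc a b ∩ Finset.Ioc c d, g (t - c) -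
      ((Finset.Ioc a b ∩ Finset.Ioc c d).card : ℝ) * r| ≤ 2 * (η * T + C) := by
  have hT : 0 ≤ η * T := by positivity
  rw [Finset.Ioc_inter_Ioc, Nat.card_Ioc]
  rcases le_total (max a c) (min b d) with h | h
  · have hc : c ≤ max a c := le_max_right _ _
    have hd' : min b d ≤ T := (min_le_right _ _).trans hd
    generalize max a c = p at *
    generalize min b d = q at *
    rw [sum_Ioc_shift g hc h]
    have h1 := abs_le.1 (hg (q - c))
    have h2 := abs_le.1 (hg (p - c))
    have e1 : η * ((q - c : ℕ) : ℝ) ≤ η * T :=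
      mul_le_mul_of_nonneg_left (by exact_mod_cast (Nat.sub_le _ _).trans hd') hη
    have e2 : η * ((p - c : ℕ) : ℝ) ≤ η * T :=
      mul_le_mul_of_nonneg_left
        (by exact_mod_cast (Nat.sub_le _ _).trans (h.trans hd')) hη
    have e3 : ((q - p : ℕ) : ℝ) = ((q - c : ℕ) : ℝ) - ((p - c : ℕ) : ℝ) := by
      rw [Nat.cast_sub h, Nat.cast_sub hc, Nat.cast_sub (hc.trans h)]
      ring
    rw [e3, abs_le]
    constructor <;> linarith [h1.1, h1.2, h2.1, h2.2]
  · rw [Finset.Ioc_eq_empty_of_le h, Nat.sub_eq_zero_of_le h]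
    simp only [Finset.sum_empty, Nat.cast_zero, zero_mul, sub_zero, abs_zero]
    positivity

lemma card_Ioc_floor_inter_ge {a b c d δ T : ℝ} (hT : 0 ≤ T) (ha : 0 ≤ a) (hc : 0 ≤ c)
    (hab : a + δ ≤ b) (had : a + δ ≤ d) (hcb : c + δ ≤ b) (hcd : c + δ ≤ d) :
    T * δ - 1 ≤ ((Finset.Ioc ⌊T * a⌋₊ ⌊T * b⌋₊ ∩ Finset.Ioc ⌊T * c⌋₊ ⌊T * d⌋₊).card : ℝ) := by
  have key {x y : ℝ} (hx : 0 ≤ x) (hxy : x + δ ≤ y) :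
      T * δ - 1 ≤ (⌊T * y⌋₊ : ℝ) - ⌊T * x⌋₊ := by
    have h1 := Nat.floor_le (mul_nonneg hT hx)
    have h2 := Nat.lt_floor_add_one (T * y)
    nlinarith [mul_le_mul_of_nonneg_left hxy hT]
  -- Truncated subtraction can only increase the value, so an empty intersection needs no separate
  -- case.
  have hsub (p q : ℕ) : (q : ℝ) - p ≤ ((q - p : ℕ) : ℝ) := by
    have : q ≤ q - p + p := by omega
    have : (q : ℝ) ≤ ((q - p : ℕ) : ℝ) + p := by exact_mod_cast this
    linarith
  rw [Finset.Ioc_inter_Ioc, Nat.card_Ioc]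
  refine le_trans ?_ (hsub _ _)
  rcases max_choice ⌊T * a⌋₊ ⌊T * c⌋₊ with h | h <;>
    rcases min_choice ⌊T * b⌋₊ ⌊T * d⌋₊ with h' | h' <;> rw [h, h']
  exacts [key ha hab, key ha had, key hc hcb, key hc hcd]

noncomputable section

variable {n₁ n₂ nw : ℕ} {ε : ℝ} {Θ : (R : Segmentation n₁ n₂) → Set (Fin R.m → Fin nw → ℝ)}

namespace SeriesModel

/-! ### Admissible models -/

lemma Admissible.strictMono {M : SeriesModel n₁ n₂ nw} (hM : M.Admissible ε Θ) (hε : 0 < ε) :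
    StrictMono M.ν :=
  Fin.strictMono_iff_lt_succ.2 fun k => by linarith [hM.2.2.2.1 k]

lemma Admissible.nonneg {M : SeriesModel n₁ n₂ nw} (hM : M.Admissible ε Θ) (hε : 0 < ε)
    (k : Fin (M.K + 2)) : 0 ≤ M.ν k :=
  hM.2.1 ▸ (hM.strictMono hε).monotone (Fin.zero_le k)

lemma Admissible.le_one {M : SeriesModel n₁ n₂ nw} (hM : M.Admissible ε Θ) (hε : 0 < ε)
    (k : Fin (M.K + 2)) : M.ν k ≤ 1 :=
  hM.2.2.1 ▸ (hM.strictMono hε).monotone (Fin.le_last k)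

lemma Admissible.tau_monotone {M : SeriesModel n₁ n₂ nw} (hM : M.Admissible ε Θ) (hε : 0 < ε)
    (T : ℕ) : Monotone (M.tau T) := fun _ _ h =>
  Nat.floor_mono (mul_le_mul_of_nonneg_left ((hM.strictMono hε).monotone h) T.cast_nonneg)

lemma Admissible.tau_zero {M : SeriesModel n₁ n₂ nw} (hM : M.Admissible ε Θ) (T : ℕ) :
    M.tau T 0 = 0 := by simp [tau, hM.2.1]

lemma Admissible.tau_last {M : SeriesModel n₁ n₂ nw} (hM : M.Admissible ε Θ) (T : ℕ) :
    M.tau T (Fin.last _) = T := by simp [tau, hM.2.2.1]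

lemma Admissible.tau_le {M : SeriesModel n₁ n₂ nw} (hM : M.Admissible ε Θ) (hε : 0 < ε) (T : ℕ)
    (k : Fin (M.K + 2)) : M.tau T k ≤ T :=
  (hM.tau_monotone hε T (Fin.le_last k)).trans_eq (hM.tau_last T)

lemma Admissible.intensity_pos {M : SeriesModel n₁ n₂ nw} (hM : M.Admissible ε Θ)
    (hΘ_pos : ∀ R, ∀ μ ∈ Θ R, ∀ h w, 0 < μ h w) (k : Fin (M.K + 1)) (i : Pixel n₁ n₂)
    (w : Fin nw) : 0 < (M.ψ k).intensity i w :=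
  hΘ_pos _ _ (hM.2.2.2.2 k) _ _

lemma Admissible.observed_eq {M : SeriesModel n₁ n₂ nw} (hM : M.Admissible ε Θ) (hε : 0 < ε)
    (x : Fin (M.K + 1) → ℕ → Pixel n₁ n₂ → Fin nw → ℕ) (T : ℕ) {t : ℕ} {k : Fin (M.K + 1)}
    (ht : t ∈ Finset.Ioc (M.tau T k.castSucc) (M.tau T k.succ)) (i : Pixel n₁ n₂) (w : Fin nw) :
    M.observed x T t i w = x k (t - M.tau T k.castSucc) i w := by
  rw [Finset.mem_Ioc] at ht
  rw [observed, Finset.sum_eq_single k, if_pos ht]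
  · intro l _ hl
    exact if_neg fun h => hl
      (eq_of_castSucc_lt_le_succ (hM.tau_monotone hε T) h.1 h.2 ht.1 ht.2)
  · simp

/-! ### The penalty -/

/-- The part of the criterion that does not depend on the data. -/
def penalty (M : SeriesModel n₁ n₂ nw) (T : ℕ) : ℝ :=
  (M.K : ℝ) * Real.log (T : ℝ)
  + ∑ k : Fin (M.K + 1),
      (((M.ψ k).seg.m : ℝ) * Real.log ((n₁ * n₂ : ℕ) : ℝ)
        + Real.log 3 / 2 * ∑ h : Fin (M.ψ k).seg.m, ((M.ψ k).seg.perimeter h : ℝ)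
        + (nw : ℝ) / 2 * ∑ h : Fin (M.ψ k).seg.m,
            Real.log (((M.tau T k.succ : ℝ) - (M.tau T k.castSucc : ℝ) + 1)
              * ((M.ψ k).seg.area h : ℝ)))

lemma mdl_eq (M : SeriesModel n₁ n₂ nw) (T : ℕ) (y : ℕ → Pixel n₁ n₂ → Fin nw → ℕ) :
    M.mdl T y = M.penalty T - ∑ k : Fin (M.K + 1),
      ∑ t ∈ Finset.Ioc (M.tau T k.castSucc) (M.tau T k.succ), (M.ψ k).logLik (y t) := rfl

end SeriesModel

lemma Segmentation.one_le_area (R : Segmentation n₁ n₂) (h : Fin R.m) : 1 ≤ R.area h :=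
  let ⟨i, hi⟩ := R.label_surjective h
  Finset.card_pos.2 ⟨i, by simpa using hi⟩

namespace SeriesModel

lemma Admissible.one_le_length_mul_area {M : SeriesModel n₁ n₂ nw} (hM : M.Admissible ε Θ)
    (hε : 0 < ε) (T : ℕ) (k : Fin (M.K + 1)) (h : Fin (M.ψ k).seg.m) :
    (1 : ℝ) ≤ ((M.tau T k.succ : ℝ) - (M.tau T k.castSucc : ℝ) + 1) * (M.ψ k).seg.area h := by
  have h1 : (M.tau T k.castSucc : ℝ) ≤ M.tau T k.succ := by
    exact_mod_cast hM.tau_monotone hε T k.castSucc_lt_succ.le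
  have h2 : (1 : ℝ) ≤ (M.ψ k).seg.area h := by exact_mod_cast (M.ψ k).seg.one_le_area h
  nlinarith

/-- For fitted models this lower bound is enough; only the penalty of the fixed true model needs an
upper estimate. -/
lemma Admissible.penalty_nonneg {M : SeriesModel n₁ n₂ nw} (hM : M.Admissible ε Θ)
    (hε : 0 < ε) (T : ℕ) : 0 ≤ M.penalty T := by
  refine add_nonneg (mul_nonneg (Nat.cast_nonneg _) (Real.log_natCast_nonneg _))
    (Finset.sum_nonneg fun k _ => add_nonneg (add_nonneg ?_ ?_) ?_)
  · exact mul_nonneg (Nat.cast_nonneg _) (Real.log_natCast_nonneg _)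
  · have := Real.log_nonneg (show (1 : ℝ) ≤ 3 by norm_num)
    exact mul_nonneg (by positivity) (Finset.sum_nonneg fun _ _ => Nat.cast_nonneg _)
  · exact mul_nonneg (by positivity)
      (Finset.sum_nonneg fun h _ => Real.log_nonneg (hM.one_le_length_mul_area hε T k h))

lemma isLittleO_log_natCast :
    (fun T : ℕ => Real.log (T : ℝ)) =o[atTop] fun T : ℕ => (T : ℝ) :=
  Real.isLittleO_log_id_atTop.comp_tendsto tendsto_natCast_atTop_atTop

lemma isLittleO_const_natCast (c : ℝ) : (fun _ : ℕ => c) =o[atTop] fun T : ℕ => (T : ℝ) :=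
  (Asymptotics.isLittleO_const_id_atTop c).comp_tendsto tendsto_natCast_atTop_atTop

lemma isLittleO_log_of_le {g : ℕ → ℝ} {A : ℝ} (hA : 1 ≤ A)
    (hg : ∀ T, 1 ≤ T → 1 ≤ g T ∧ g T ≤ A * T) :
    (fun T => Real.log (g T)) =o[atTop] fun T : ℕ => (T : ℝ) := by
  refine Asymptotics.IsBigO.trans_isLittleO (Asymptotics.IsBigO.of_bound 1 ?_)
    ((isLittleO_const_natCast (Real.log A)).add isLittleO_log_natCast)
  filter_upwards [eventually_ge_atTop 1] with T hT
  obtain ⟨h1, h2⟩ := hg T hT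
  have hT' : (T : ℝ) ≠ 0 := by positivity
  rw [one_mul, ← Real.log_mul (by positivity) hT', Real.norm_of_nonneg (Real.log_nonneg h1),
    Real.norm_of_nonneg (Real.log_nonneg (h1.trans h2))]
  exact Real.log_le_log (by linarith) h2

lemma Admissible.isLittleO_penalty {M : SeriesModel n₁ n₂ nw} (hM : M.Admissible ε Θ)
    (hε : 0 < ε) : M.penalty =o[atTop] fun T : ℕ => (T : ℝ) := by
  unfold penalty
  refine (isLittleO_log_natCast.const_mul_left _).add
    (Asymptotics.IsLittleO.fun_sum fun k _ => ?_)
  refine (isLittleO_const_natCast _).add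
    ((Asymptotics.IsLittleO.fun_sum fun h _ => ?_).const_mul_left _)
  have h2 : (1 : ℝ) ≤ (M.ψ k).seg.area h := by exact_mod_cast (M.ψ k).seg.one_le_area h
  -- The length plus one is at most `T + 1 ≤ 2 * T`.
  refine isLittleO_log_of_le (A := 2 * (M.ψ k).seg.area h) (by linarith)
    fun T hT => ⟨hM.one_le_length_mul_area hε T k h, ?_⟩
  have h3 : (M.tau T k.succ : ℝ) ≤ T := by exact_mod_cast hM.tau_le hε T _
  have h4 : (0 : ℝ) ≤ M.tau T k.castSucc := Nat.cast_nonneg _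
  have h5 : (1 : ℝ) ≤ T := by exact_mod_cast hT
  nlinarith

end SeriesModel

/-! ### Comparison of the likelihoods -/

/-- Exact split into drift and noise. The fitted rates enter the noise only as logarithms
multiplying count deviations, so a law of large numbers for counts alone gives uniformity in `ψ`. -/
lemma RegionModel.sum_logLik_sub (ψo ψ : RegionModel n₁ n₂ nw) (s : Finset ℕ)
    (y : ℕ → Pixel n₁ n₂ → Fin nw → ℕ) :
    ∑ t ∈ s, (ψo.logLik (y t) - ψ.logLik (y t)) = s.card * ψo.div ψ +
      ∑ i, ∑ w, (∑ t ∈ s, (y t i w : ℝ) - s.card * ψo.intensity i w) *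
        (Real.log (ψo.intensity i w) - Real.log (ψ.intensity i w)) := by
  simp_rw [RegionModel.logLik_eq_sum, RegionModel.div, Finset.mul_sum, ← Finset.sum_sub_distrib,
    ← Finset.sum_add_distrib]
  rw [Finset.sum_comm]
  refine Finset.sum_congr rfl fun i _ => ?_
  rw [Finset.sum_comm]
  refine Finset.sum_congr rfl fun w _ => ?_
  simp only [poissonDiv, Finset.sum_sub_distrib, Finset.sum_const, nsmul_eq_mul,
    ← Finset.sum_mul]
  ring

lemma RegionModel.card_mul_div_sub_le (ψo ψ : RegionModel n₁ n₂ nw) (s : Finset ℕ)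
    (y : ℕ → Pixel n₁ n₂ → Fin nw → ℕ) {E B : ℝ} (hE : 0 ≤ E)
    (hy : ∀ i w, |∑ t ∈ s, (y t i w : ℝ) - s.card * ψo.intensity i w| ≤ E)
    (ho : ∀ i w, |Real.log (ψo.intensity i w)| ≤ B)
    (h : ∀ i w, |Real.log (ψ.intensity i w)| ≤ B) :
    s.card * ψo.div ψ - Fintype.card (Pixel n₁ n₂) * nw * (E * (2 * B)) ≤
      ∑ t ∈ s, (ψo.logLik (y t) - ψ.logLik (y t)) := by
  rw [RegionModel.sum_logLik_sub, sub_eq_add_neg]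
  refine add_le_add le_rfl (neg_le_of_abs_le ?_)
  have hb (i : Pixel n₁ n₂) (w : Fin nw) :
      |(∑ t ∈ s, (y t i w : ℝ) - s.card * ψo.intensity i w) *
        (Real.log (ψo.intensity i w) - Real.log (ψ.intensity i w))| ≤ E * (2 * B) := by
    rw [abs_mul]
    refine mul_le_mul (hy i w) ?_ (abs_nonneg _) hE
    linarith [abs_sub (Real.log (ψo.intensity i w)) (Real.log (ψ.intensity i w)), ho i w, h i w]
  calc _ ≤ ∑ i : Pixel n₁ n₂, ∑ w : Fin nw, E * (2 * B) :=
        (Finset.abs_sum_le_sum_abs _ _).trans <| Finset.sum_le_sum fun i _ =>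
          (Finset.abs_sum_le_sum_abs _ _).trans <| Finset.sum_le_sum fun w _ => hb i w
    _ = _ := by
        simp only [Finset.sum_const, Finset.card_univ, nsmul_eq_mul, Fintype.card_fin]
        ring

/-- The time points that are in the `j`-th interval of `M` and in the `k`-th interval of `M'`. -/
def SeriesModel.cell (M M' : SeriesModel n₁ n₂ nw) (T : ℕ) (j : Fin (M.K + 1))
    (k : Fin (M'.K + 1)) : Finset ℕ :=
  Finset.Ioc (M.tau T j.castSucc) (M.tau T j.succ) ∩
    Finset.Ioc (M'.tau T k.castSucc) (M'.tau T k.succ)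

lemma SeriesModel.Admissible.mdl_sub_mdl {M M' : SeriesModel n₁ n₂ nw} (hM : M.Admissible ε Θ)
    (hM' : M'.Admissible ε Θ) (hε : 0 < ε) (T : ℕ) (y : ℕ → Pixel n₁ n₂ → Fin nw → ℕ) :
    M.mdl T y - M'.mdl T y = M.penalty T - M'.penalty T +
      ∑ j, ∑ k, ∑ t ∈ M.cell M' T j k, ((M'.ψ k).logLik (y t) - (M.ψ j).logLik (y t)) := by
  rw [mdl_eq, mdl_eq,
    sum_sum_Ioc_inter (hM.tau_monotone hε T) (hM'.tau_monotone hε T)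
      (by rw [hM.tau_zero, hM'.tau_zero]) (by rw [hM.tau_last, hM'.tau_last])
      fun k t => (M.ψ k).logLik (y t),
    sum_sum_Ioc_inter (hM'.tau_monotone hε T) (hM.tau_monotone hε T)
      (by rw [hM.tau_zero, hM'.tau_zero]) (by rw [hM.tau_last, hM'.tau_last])
      fun k t => (M'.ψ k).logLik (y t), Finset.sum_comm (γ := Fin (M'.K + 1))]
  simp only [cell, Finset.sum_sub_distrib]
  simp only [Finset.inter_comm (Finset.Ioc (M'.tau T _) (M'.tau T _))]
  ring

/-- The models that are at least as good as the true one have small divergence from it,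
weighted by the number of time points. -/
theorem eventually_card_cell_mul_div_le (hΘ_compact : ∀ R, IsCompact (Θ R))
    (hΘ_pos : ∀ R, ∀ μ ∈ Θ R, ∀ h w, 0 < μ h w) (hε : 0 < ε)
    {Mo : SeriesModel n₁ n₂ nw} (hMo : Mo.Admissible ε Θ)
    {x : Fin (Mo.K + 1) → ℕ → Pixel n₁ n₂ → Fin nw → ℕ}
    (hx : ∀ k i w, Tendsto (fun n : ℕ => (∑ s ∈ Finset.range n, (x k (s + 1) i w : ℝ)) / n)
      atTop (𝓝 ((Mo.ψ k).intensity i w))) {η : ℝ} (hη : 0 < η) :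
    ∀ᶠ T : ℕ in atTop, ∀ M : SeriesModel n₁ n₂ nw, IsMDLEstimate ε Θ T (Mo.observed x T) M →
      ∀ j k, ((M.cell Mo T j k).card : ℝ) * (Mo.ψ k).div (M.ψ j) ≤ η * T := by
  obtain ⟨B, hB0, hB⟩ := exists_abs_log_intensity_le hΘ_compact hΘ_pos
  -- The noise in one cell is at most `D * (η' * T + C)`, and `L` bounds the number of cells. With
  -- `η'` as below, the true penalty, `L * D * η' * T` and `L * D * C` are each eventually at most
  -- `η * T / 4`.
  set D : ℝ := Fintype.card (Pixel n₁ n₂) * nw * (2 * (2 * B)) with hD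
  have hD0 : 0 ≤ D := by positivity
  set L : ℝ := ((⌊1 / ε⌋₊ + 2 : ℕ) : ℝ) * ((Mo.K + 1 : ℕ) : ℝ) with hL
  have hL0 : 0 ≤ L := by positivity
  set η' : ℝ := η / (4 * (L * D + 1)) with hη'
  have hη'0 : 0 < η' := by positivity
  have hdev (p : Fin (Mo.K + 1) × Pixel n₁ n₂ × Fin nw) :=
    exists_abs_sub_le_of_tendsto_div (hx p.1 p.2.1 p.2.2) hη'0
  choose C' hC'0 hC' using hdev
  obtain ⟨C₁, hC₁⟩ := (Set.finite_range C').bddAbove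
  set C := max C₁ 0
  have hC0 : 0 ≤ C := le_max_right _ _
  have hC (k : Fin (Mo.K + 1)) (i : Pixel n₁ n₂) (w : Fin nw) (n : ℕ) :
      |∑ s ∈ Finset.range n, (x k (s + 1) i w : ℝ) - n * (Mo.ψ k).intensity i w|
        ≤ η' * n + C :=
    (hC' (k, i, w) n).trans
      (add_le_add le_rfl ((hC₁ ⟨(k, i, w), rfl⟩).trans (le_max_left _ _)))
  have hpen := (hMo.isLittleO_penalty hε).bound (show 0 < η / 4 by positivity)
  have hconst := (SeriesModel.isLittleO_const_natCast (L * D * C)).bound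
    (show 0 < η / 4 by positivity)
  filter_upwards [hpen, hconst, eventually_ge_atTop 1] with T hpen hconst hT M hM
  have hT' : (0 : ℝ) < T := by exact_mod_cast hT
  obtain ⟨hadm, hmin⟩ := hM
  -- Minimality is used only against the true model.
  have hle := le_of_mul_le_mul_left (hmin Mo hMo) (by positivity)
  have hsub := hadm.mdl_sub_mdl hMo hε T (Mo.observed x T)
  set F : ℝ := D * (η' * T + C) with hF
  have hF0 : 0 ≤ F := by positivity
  have hcell (j : Fin (M.K + 1)) (k : Fin (Mo.K + 1)) :
      (M.cell Mo T j k).card * (Mo.ψ k).div (M.ψ j) - F ≤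
        ∑ t ∈ M.cell Mo T j k, ((Mo.ψ k).logLik (Mo.observed x T t) -
          (M.ψ j).logLik (Mo.observed x T t)) := by
    have := (Mo.ψ k).card_mul_div_sub_le (M.ψ j) (M.cell Mo T j k) (Mo.observed x T)
      (E := 2 * (η' * T + C)) (B := B) (by positivity) (fun i w => ?_)
      (hB _ (hMo.2.2.2.2 k)) (hB _ (hadm.2.2.2.2 j))
    · refine le_trans (le_of_eq ?_) this
      rw [hF, hD]
      ring
    · have h := abs_sum_Ioc_inter_sub_le (g := fun s => (x k s i w : ℝ)) hη'0.le hC0 (hC k i w)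
        (a := M.tau T j.castSucc) (b := M.tau T j.succ) (c := Mo.tau T k.castSucc)
        (hMo.tau_le hε T k.succ)
      rw [SeriesModel.cell, Finset.sum_congr rfl fun t ht => by
        rw [hMo.observed_eq hε x T (Finset.mem_inter.1 ht).2 i w]]
      exact h
  have hdiv (j : Fin (M.K + 1)) (k : Fin (Mo.K + 1)) :
      0 ≤ ((M.cell Mo T j k).card : ℝ) * (Mo.ψ k).div (M.ψ j) :=
    mul_nonneg (Nat.cast_nonneg _) (RegionModel.div_nonneg
      (fun i w => hMo.intensity_pos hΘ_pos k i w) fun i w => hadm.intensity_pos hΘ_pos j i w)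
  have hsum := Finset.sum_le_sum fun j (_ : j ∈ Finset.univ) =>
    Finset.sum_le_sum fun k (_ : k ∈ Finset.univ) => hcell j k
  simp only [Finset.sum_sub_distrib, Finset.sum_const, Finset.card_univ, nsmul_eq_mul,
    Fintype.card_fin] at hsum
  have hcount : ((M.K + 1 : ℕ) : ℝ) * (((Mo.K + 1 : ℕ) : ℝ) * F) ≤ L * F := by
    rw [← mul_assoc]
    refine mul_le_mul_of_nonneg_right (mul_le_mul_of_nonneg_right ?_ (Nat.cast_nonneg _)) hF0
    exact_mod_cast Nat.succ_le_succ hadm.1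
  intro j k
  have hone : ((M.cell Mo T j k).card : ℝ) * (Mo.ψ k).div (M.ψ j) ≤
      ∑ j, ∑ k, ((M.cell Mo T j k).card : ℝ) * (Mo.ψ k).div (M.ψ j) :=
    (Finset.single_le_sum (fun k _ => hdiv j k) (Finset.mem_univ k)).trans
      (Finset.single_le_sum (f := fun j => ∑ k, ((M.cell Mo T j k).card : ℝ) *
        (Mo.ψ k).div (M.ψ j)) (fun j _ => Finset.sum_nonneg fun k _ => hdiv j k)
        (Finset.mem_univ j))
  have hpenM := hadm.penalty_nonneg hε T
  have hLF : L * F ≤ η / 4 * T + L * D * C := by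
    have : L * D * η' ≤ η / 4 := by
      rw [hη', mul_div_assoc', div_le_iff₀ (by positivity)]
      nlinarith
    rw [hF]
    nlinarith
  rw [Real.norm_eq_abs, Real.norm_of_nonneg hT'.le] at hpen hconst
  have h1 := (le_abs_self _).trans hpen
  have h2 := (le_abs_self _).trans hconst
  simp only [Finset.sum_sub_distrib] at hsub hsum
  have : 0 < η * T := by positivity
  linarith

end

/-! ### Consequences of small divergence for the fitted intervals. -/

section

variable {n₁ n₂ nw : ℕ} {ε : ℝ} {Θ : (R : Segmentation n₁ n₂) → Set (Fin R.m → Fin nw → ℝ)}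

/-- Where a fitted interval overlaps a true one, the fitted region model is close to the true
one. -/
theorem eventually_div_le_of_overlap (hΘ_compact : ∀ R, IsCompact (Θ R))
    (hΘ_pos : ∀ R, ∀ μ ∈ Θ R, ∀ h w, 0 < μ h w) (hε : 0 < ε)
    {Mo : SeriesModel n₁ n₂ nw} (hMo : Mo.Admissible ε Θ)
    {x : Fin (Mo.K + 1) → ℕ → Pixel n₁ n₂ → Fin nw → ℕ}
    (hx : ∀ k i w, Tendsto (fun n : ℕ => (∑ s ∈ Finset.range n, (x k (s + 1) i w : ℝ)) / n)
      atTop (𝓝 ((Mo.ψ k).intensity i w))) {δ η : ℝ} (hδ : 0 < δ) (hη : 0 < η) :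
    ∀ᶠ T : ℕ in atTop, ∀ M : SeriesModel n₁ n₂ nw, IsMDLEstimate ε Θ T (Mo.observed x T) M →
      ∀ j k, M.ν j.castSucc + δ ≤ M.ν j.succ → M.ν j.castSucc + δ ≤ Mo.ν k.succ →
        Mo.ν k.castSucc + δ ≤ M.ν j.succ → Mo.ν k.castSucc + δ ≤ Mo.ν k.succ →
        (Mo.ψ k).div (M.ψ j) ≤ η := by
  -- For such `T` the overlap, of at least `T * δ - 1` times, has at least `T * δ / 2`.
  have hlarge : ∀ᶠ T : ℕ in atTop, 2 / δ ≤ (T : ℝ) :=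
    tendsto_natCast_atTop_atTop.eventually_ge_atTop _
  filter_upwards [eventually_card_cell_mul_div_le hΘ_compact hΘ_pos hε hMo hx
    (show 0 < η * (δ / 2) by positivity), hlarge, eventually_ge_atTop 1]
    with T hT hlarge hT1 M hM j k h1 h2 h3 h4
  have hT' : (0 : ℝ) < T := by exact_mod_cast hT1
  have hcard := card_Ioc_floor_inter_ge hT'.le (hM.1.nonneg hε j.castSucc)
    (hMo.nonneg hε k.castSucc) h1 h2 h3 h4
  have hdiv := hT M hM j k
  have hnn : 0 ≤ (Mo.ψ k).div (M.ψ j) := RegionModel.div_nonneg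
    (fun i w => hMo.intensity_pos hΘ_pos k i w) fun i w => hM.1.intensity_pos hΘ_pos j i w
  rw [div_le_iff₀ hδ] at hlarge
  have hhalf : (T : ℝ) * (δ / 2) ≤ ((M.cell Mo T j k).card : ℝ) := by
    refine le_trans ?_ hcard
    linarith
  have := (mul_le_mul_of_nonneg_right hhalf hnn).trans hdiv
  refine le_of_mul_le_mul_left ?_ (show 0 < (T : ℝ) * (δ / 2) by positivity)
  linarith

/-- No true change point lies inside a fitted interval away from its ends. -/
theorem eventually_not_changePoint_interior (hΘ_compact : ∀ R, IsCompact (Θ R))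
    (hΘ_pos : ∀ R, ∀ μ ∈ Θ R, ∀ h w, 0 < μ h w) (hε : 0 < ε)
    {Mo : SeriesModel n₁ n₂ nw} (hMo : Mo.Admissible ε Θ)
    (hintervals : ∀ k : Fin Mo.K, ∃ (i : Pixel n₁ n₂) (w : Fin nw),
      0 < |(Mo.ψ k.succ).intensity i w - (Mo.ψ k.castSucc).intensity i w|)
    {x : Fin (Mo.K + 1) → ℕ → Pixel n₁ n₂ → Fin nw → ℕ}
    (hx : ∀ k i w, Tendsto (fun n : ℕ => (∑ s ∈ Finset.range n, (x k (s + 1) i w : ℝ)) / n)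
      atTop (𝓝 ((Mo.ψ k).intensity i w))) {δ : ℝ} (hδ : 0 < δ) (hδε : δ ≤ ε) :
    ∀ᶠ T : ℕ in atTop, ∀ M : SeriesModel n₁ n₂ nw, IsMDLEstimate ε Θ T (Mo.observed x T) M →
      ∀ (j : Fin (M.K + 1)) (k : Fin Mo.K),
        M.ν j.castSucc + δ ≤ Mo.changePoint k → M.ν j.succ < Mo.changePoint k + δ := by
  have hc (k : Fin Mo.K) : ∃ c, 0 < c ∧ ∀ ψ : RegionModel n₁ n₂ nw, ψ.rate ∈ Θ ψ.seg →
      c ≤ (Mo.ψ k.succ).div ψ + (Mo.ψ k.castSucc).div ψ := by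
    obtain ⟨i, w, h⟩ := hintervals k
    exact exists_pos_le_div_add_div hΘ_compact hΘ_pos (hMo.intensity_pos hΘ_pos _)
      (hMo.intensity_pos hΘ_pos _) (sub_ne_zero.1 (abs_pos.1 h))
  choose c hc0 hc using hc
  have hev (k : Fin Mo.K) := eventually_div_le_of_overlap hΘ_compact hΘ_pos hε hMo hx hδ
    (show 0 < c k / 3 by linarith [hc0 k])
  filter_upwards [eventually_all.2 hev] with T hT M hM j k h1
  by_contra! h2
  have hk1 := hMo.2.2.2.1 k.castSucc
  have hk2 := hMo.2.2.2.1 k.succ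
  rw [Fin.succ_castSucc] at hk1
  unfold SeriesModel.changePoint at h1 h2
  -- The fitted interval reaches `δ` into both true intervals adjacent to the change point, so the
  -- two divergences sum to at most `2 * c k / 3`, less than their lower bound `c k`.
  have d1 := hT k M hM j k.castSucc (by linarith) (by rw [Fin.succ_castSucc]; exact h1)
    (by linarith) (by rw [Fin.succ_castSucc]; linarith)
  have d2 := hT k M hM j k.succ (by linarith) (by linarith) h2 (by linarith)
  linarith [hc k _ (hM.1.2.2.2.2 j), hc0 k]

/-- A fitted interval that overlaps a true interval oversegments it. -/
theorem eventually_oversegments_of_overlap (hnw : 0 < nw) (hΘ_compact : ∀ R, IsCompact (Θ R))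
    (hΘ_pos : ∀ R, ∀ μ ∈ Θ R, ∀ h w, 0 < μ h w) (hε : 0 < ε)
    {Mo : SeriesModel n₁ n₂ nw} (hMo : Mo.Admissible ε Θ)
    (hregions : ∀ (k : Fin (Mo.K + 1)) (i j : Pixel n₁ n₂), (pixelGraph n₁ n₂).Adj i j →
      (Mo.ψ k).seg.label i ≠ (Mo.ψ k).seg.label j →
      ∀ w : Fin nw, 0 < |(Mo.ψ k).intensity i w - (Mo.ψ k).intensity j w|)
    {x : Fin (Mo.K + 1) → ℕ → Pixel n₁ n₂ → Fin nw → ℕ}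
    (hx : ∀ k i w, Tendsto (fun n : ℕ => (∑ s ∈ Finset.range n, (x k (s + 1) i w : ℝ)) / n)
      atTop (𝓝 ((Mo.ψ k).intensity i w))) {δ : ℝ} (hδ : 0 < δ) (hδε : δ ≤ ε) :
    ∀ᶠ T : ℕ in atTop, ∀ M : SeriesModel n₁ n₂ nw, IsMDLEstimate ε Θ T (Mo.observed x T) M →
      ∀ j k, M.ν j.castSucc + δ ≤ Mo.ν k.succ → Mo.ν k.castSucc + δ ≤ M.ν j.succ →
        Oversegments (M.ψ j).seg (Mo.ψ k).seg := by
  -- Rates of neighbouring regions differ in every band, and any one band suffices.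
  have hc (k : Fin (Mo.K + 1)) := exists_pos_le_div_of_not_oversegments hΘ_compact hΘ_pos
    (ψo := Mo.ψ k) (hMo.intensity_pos hΘ_pos k) ⟨0, hnw⟩
    fun i j hij hl => sub_ne_zero.1 (abs_pos.1 (hregions k i j hij hl _))
  choose c hc0 hc using hc
  have hev (k : Fin (Mo.K + 1)) := eventually_div_le_of_overlap hΘ_compact hΘ_pos hε hMo hx hδ
    (show 0 < c k / 2 by linarith [hc0 k])
  filter_upwards [eventually_all.2 hev] with T hT M hM j k h1 h2
  by_contra h
  have hj := hM.1.2.2.2.1 j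
  have hk := hMo.2.2.2.1 k
  linarith [hT k M hM j k (by linarith) h1 h2 (by linarith), hc k _ (hM.1.2.2.2.2 j) h, hc0 k]

/-! ### Positions of separated change points. -/

namespace SeriesModel

lemma Admissible.lt_changePoint {M : SeriesModel n₁ n₂ nw} (hM : M.Admissible ε Θ) (hε : 0 < ε)
    (k : Fin M.K) : ε < M.changePoint k := by
  have h1 := hM.2.2.2.1 k.castSucc
  rw [Fin.succ_castSucc] at h1
  unfold changePoint
  linarith [hM.nonneg hε k.castSucc.castSucc]

lemma Admissible.changePoint_lt {M : SeriesModel n₁ n₂ nw} (hM : M.Admissible ε Θ) (hε : 0 < ε)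
    (k : Fin M.K) : M.changePoint k < 1 - ε := by
  have h1 := hM.2.2.2.1 k.succ
  unfold changePoint
  linarith [hM.le_one hε k.succ.succ]

lemma Admissible.lt_changePoint_sub {M : SeriesModel n₁ n₂ nw} (hM : M.Admissible ε Θ)
    (hε : 0 < ε) {k l : Fin M.K} (hkl : k < l) : ε < M.changePoint l - M.changePoint k := by
  have h1 := hM.2.2.2.1 k.succ
  have h2 : M.ν k.succ.succ ≤ M.ν l.succ.castSucc :=
    (hM.strictMono hε).monotone (Fin.succ_le_castSucc_iff.2 (Fin.succ_lt_succ_iff.2 hkl))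
  unfold changePoint
  linarith

/-- A point of the open unit interval that is not inside an interval of `M` away from its ends
is close to a change point. -/
lemma Admissible.exists_changePoint_near {M : SeriesModel n₁ n₂ nw} (hM : M.Admissible ε Θ)
    {δ a : ℝ} (ha0 : δ ≤ a) (ha1 : a + δ ≤ 1) (hδ : 0 < δ)
    (h : ∀ j : Fin (M.K + 1), M.ν j.castSucc + δ ≤ a → M.ν j.succ < a + δ) :
    ∃ j : Fin M.K, |M.changePoint j - a| < δ := by
  obtain ⟨j, hj, hj'⟩ := exists_castSucc_lt_le_succ M.ν (t := a) (by rw [hM.2.1]; linarith)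
    (by rw [hM.2.2.1]; linarith)
  -- Either `a` is near the left end, which is not `0` as `δ ≤ a`, or `h` puts it near the right
  -- end, which is not `1` as `a + δ ≤ 1`.
  rcases lt_or_ge a (M.ν j.castSucc + δ) with hlt | hge
  · rcases Fin.eq_zero_or_eq_succ j with rfl | ⟨i, rfl⟩
    · rw [Fin.castSucc_zero, hM.2.1] at hlt
      linarith
    · refine ⟨i, ?_⟩
      rw [changePoint, abs_lt]
      constructor <;> linarith
  · have hlt := h j hge
    rcases Fin.eq_castSucc_or_eq_last j with ⟨i, rfl⟩ | rfl
    · refine ⟨i, ?_⟩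
      rw [Fin.succ_castSucc] at hlt hj'
      rw [changePoint, abs_lt]
      constructor <;> linarith
    · rw [Fin.succ_last, hM.2.2.1] at hlt
      linarith

/-- Change points of `Mo` are more than `ε` apart, so none of `M` is within `ε / 2` of two of them,
and the choice is injective. -/
lemma Admissible.K_le_of_changePoint_near {Mo M : SeriesModel n₁ n₂ nw}
    (hMo : Mo.Admissible ε Θ) (hε : 0 < ε)
    (h : ∀ k : Fin Mo.K, ∃ j : Fin M.K, |M.changePoint j - Mo.changePoint k| < ε / 2) :
    Mo.K ≤ M.K := by
  choose f hf using h
  have hinj : Function.Injective f := by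
    intro k l hkl
    have h1 := abs_lt.1 (hf k)
    have h2 := abs_lt.1 (hf l)
    rw [← hkl] at h2
    by_contra hne
    rcases lt_or_gt_of_ne hne with hlt | hlt <;>
      linarith [hMo.lt_changePoint_sub hε hlt]
  simpa using Fintype.card_le_of_injective f hinj

/-- If no change point of `Mo` is inside an interval of `M` away from its ends, then every
interval of `M` is nearly contained in an interval of `Mo`. -/
lemma Admissible.exists_interval_near {Mo M : SeriesModel n₁ n₂ nw} (hMo : Mo.Admissible ε Θ)
    (hM : M.Admissible ε Θ) (hε : 0 < ε) {δ : ℝ} (hδ : 0 < δ) (hδε : δ ≤ ε)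
    (j : Fin (M.K + 1))
    (h : ∀ k, M.ν j.castSucc + δ ≤ Mo.changePoint k → M.ν j.succ < Mo.changePoint k + δ) :
    ∃ k : Fin (Mo.K + 1), Mo.ν k.castSucc - δ < M.ν j.castSucc ∧ M.ν j.succ < Mo.ν k.succ + δ ∧
      M.ν j.castSucc + δ ≤ Mo.ν k.succ := by
  have hj := hM.2.2.2.1 j
  have hj0 := hM.nonneg hε j.castSucc
  have hj1 := hM.le_one hε j.succ
  -- Locating the left end moved by `δ` skips a true interval that ends just after it.
  obtain ⟨k, hk, hk'⟩ := exists_castSucc_lt_le_succ Mo.ν (t := M.ν j.castSucc + δ)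
    (by rw [hMo.2.1]; linarith) (by rw [hMo.2.2.1]; linarith)
  refine ⟨k, by linarith, ?_, hk'⟩
  rcases Fin.eq_castSucc_or_eq_last k with ⟨i, rfl⟩ | rfl
  · rw [Fin.succ_castSucc] at hk' ⊢
    exact h i hk'
  · rw [Fin.succ_last, hMo.2.2.1]
    linarith

end SeriesModel

/-- Every sequence of photon counts obeys the law of large numbers. -/
theorem ae_tendsto_average {Ω : Type*} [MeasurableSpace Ω] {P : Measure Ω}
    {Mo : SeriesModel n₁ n₂ nw} (hpos : ∀ k i w, 0 < (Mo.ψ k).intensity i w)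
    {X : Fin (Mo.K + 1) → ℕ → Pixel n₁ n₂ → Fin nw → Ω → ℕ}
    (hX_law : ∀ k s i w, HasLaw (X k s i w)
      (poissonMeasure ((Mo.ψ k).intensity i w).toNNReal) P)
    (hX_indep : iIndepFun
      (fun p : Fin (Mo.K + 1) × ℕ × Pixel n₁ n₂ × Fin nw => X p.1 p.2.1 p.2.2.1 p.2.2.2) P) :
    ∀ᵐ ω ∂P, ∀ k i w, Tendsto
      (fun n : ℕ => (∑ s ∈ Finset.range n, (X k (s + 1) i w ω : ℝ)) / n) atTop
      (𝓝 ((Mo.ψ k).intensity i w)) := by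
  simp_rw [ae_all_iff]
  intro k i w
  -- Images within an interval are numbered from `1`, hence the shift.
  have h := ae_tendsto_average_poisson (Y := fun s => X k (s + 1) i w)
    (fun s => hX_law k (s + 1) i w) fun s t hst =>
      hX_indep.indepFun (i := (k, s + 1, i, w)) (j := (k, t + 1, i, w)) (by simpa using hst)
  rwa [Real.coe_toNNReal _ (hpos k i w).le] at h

end

/-! ### The almost sure conclusions. -/

theorem mainTheorem4
    {Ω : Type*} [MeasurableSpace Ω] (P : Measure Ω) [IsProbabilityMeasure P]
    (n₁ n₂ nw : ℕ) (hnw : 0 < nw)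
    -- the class of models: compact spaces of positive rates
    (Θ : (R : Segmentation n₁ n₂) → Set (Fin R.m → Fin nw → ℝ))
    (hΘ_compact : ∀ R, IsCompact (Θ R))
    (hΘ_pos : ∀ R, ∀ μ ∈ Θ R, ∀ h w, 0 < μ h w)
    (ε : ℝ) (hε : 0 < ε)
    -- the true model
    (Mo : SeriesModel n₁ n₂ nw) (hMo : Mo.Admissible ε Θ)
    -- neighbouring true regions have different rates, in every band
    (hregions : ∀ (k : Fin (Mo.K + 1)) (i j : Pixel n₁ n₂), (pixelGraph n₁ n₂).Adj i j →
      (Mo.ψ k).seg.label i ≠ (Mo.ψ k).seg.label j →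
      ∀ w : Fin nw, 0 < |(Mo.ψ k).intensity i w - (Mo.ψ k).intensity j w|)
    -- consecutive true intervals differ, at some pixel in some band
    (hintervals : ∀ k : Fin Mo.K, ∃ (i : Pixel n₁ n₂) (w : Fin nw),
      0 < |(Mo.ψ k.succ).intensity i w - (Mo.ψ k.castSucc).intensity i w|)
    -- the photon counts
    (X : Fin (Mo.K + 1) → ℕ → Pixel n₁ n₂ → Fin nw → Ω → ℕ)
    (hX_law : ∀ k s i w, HasLaw (X k s i w)
      (poissonMeasure ((Mo.ψ k).intensity i w).toNNReal) P)
    (hX_indep : iIndepFun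
      (fun p : Fin (Mo.K + 1) × ℕ × Pixel n₁ n₂ × Fin nw => X p.1 p.2.1 p.2.2.1 p.2.2.2) P)
    -- the MDL estimator
    (est : ℕ → Ω → SeriesModel n₁ n₂ nw)
    (hest : ∀ T : ℕ, 1 ≤ T → ∀ᵐ ω ∂P,
      IsMDLEstimate ε Θ T (Mo.observed (fun k s i w => X k s i w ω) T) (est T ω)) :
    -- the number of change points is not underestimated
    (∀ᵐ ω ∂P, ∀ᶠ T : ℕ in atTop, Mo.K ≤ (est T ω).K) ∧
    -- when it is overestimated, the true change points are among the limits of the estimated ones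
    (∀ᵐ ω ∂P,
      (∀ δ : ℝ, 0 < δ → ∀ᶠ T : ℕ in atTop, Mo.K < (est T ω).K →
        ∀ k : Fin Mo.K, ∃ j : Fin (est T ω).K,
          |(est T ω).changePoint j - Mo.changePoint k| < δ) ∧
      (∀ (φ : ℕ → ℕ), StrictMono φ → ∀ (K : ℕ), Mo.K < K →
        ∀ (hK : ∀ n, (est (φ n) ω).K = K) (νlim : Fin K → ℝ),
        (∀ j : Fin K, Tendsto (fun n => (est (φ n) ω).changePoint (Fin.cast (hK n).symm j))
          atTop (𝓝 (νlim j))) →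
        Set.range Mo.changePoint ⊆ Set.range νlim)) ∧
    -- every fitted interval lies, up to `δ`, in a true interval, whose segmentation is the fitted
    -- one or is oversegmented by it
    (∀ᵐ ω ∂P, ∀ δ : ℝ, 0 < δ → ∀ᶠ T : ℕ in atTop,
      ∀ j : Fin ((est T ω).K + 1), ∃ k : Fin (Mo.K + 1),
        Mo.ν k.castSucc - δ < (est T ω).ν j.castSucc ∧
        (est T ω).ν j.succ < Mo.ν k.succ + δ ∧
        Oversegments ((est T ω).ψ j).seg (Mo.ψ k).seg) := by
  have hlln := ae_tendsto_average (hMo.intensity_pos hΘ_pos) hX_law hX_indep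
  have hest' : ∀ᵐ ω ∂P, ∀ T : ℕ, 1 ≤ T →
      IsMDLEstimate ε Θ T (Mo.observed (fun k s i w => X k s i w ω) T) (est T ω) := by
    simpa only [ae_all_iff] using hest
  -- The exceptional null set does not depend on `δ`, since the argument is deterministic once `ω`
  -- is fixed.
  have hint : ∀ᵐ ω ∂P, ∀ δ : ℝ, 0 < δ → δ ≤ ε → ∀ᶠ T : ℕ in atTop,
      ∀ (j : Fin ((est T ω).K + 1)) (k : Fin Mo.K),
      (est T ω).ν j.castSucc + δ ≤ Mo.changePoint k →
        (est T ω).ν j.succ < Mo.changePoint k + δ := by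
    filter_upwards [hlln, hest'] with ω hω hω' δ hδ hδε
    filter_upwards [eventually_not_changePoint_interior hΘ_compact hΘ_pos hε hMo hintervals
      (x := fun k s i w => X k s i w ω) hω hδ hδε, eventually_ge_atTop 1] with T hT hT1
    exact hT _ (hω' T hT1)
  have hnear : ∀ᵐ ω ∂P, ∀ δ : ℝ, 0 < δ → ∀ᶠ T : ℕ in atTop,
      ∀ k : Fin Mo.K, ∃ j : Fin (est T ω).K,
        |(est T ω).changePoint j - Mo.changePoint k| < δ := by
    filter_upwards [hint, hest'] with ω hω hω' δ hδ
    filter_upwards [hω (min δ ε) (lt_min hδ hε) (min_le_right _ _), eventually_ge_atTop 1]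
      with T hT hT1 k
    have hle := min_le_right δ ε
    obtain ⟨j, hj⟩ := (hω' T hT1).1.exists_changePoint_near
      (by linarith [hMo.lt_changePoint hε k]) (by linarith [hMo.changePoint_lt hε k])
      (lt_min hδ hε) fun j => hT j k
    exact ⟨j, hj.trans_le (min_le_left _ _)⟩
  refine ⟨?_, ?_, ?_⟩
  · filter_upwards [hnear] with ω hω
    filter_upwards [hω (ε / 2) (by linarith)] with T hT
    exact hMo.K_le_of_changePoint_near hε hT
  · filter_upwards [hnear] with ω hω
    refine ⟨fun δ hδ => (hω δ hδ).mono fun T hT _ => hT, ?_⟩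
    rintro φ hφ K - hK νlim hlim _ ⟨k, rfl⟩
    by_contra hk
    have hpos (j : Fin K) : 0 < |νlim j - Mo.changePoint k| :=
      abs_pos.2 (sub_ne_zero.2 fun h => hk ⟨j, h⟩)
    -- A true change point missed by all limits is at distance at least some `d > 0` from them,
    -- while an estimate eventually comes within `d / 2` of it and of its own limit.
    obtain ⟨d, hd0, hd⟩ : ∃ d : ℝ, 0 < d ∧ ∀ j, d ≤ |νlim j - Mo.changePoint k| := by
      rcases isEmpty_or_nonempty (Fin K) with h | h
      · exact ⟨1, one_pos, fun j => h.elim j⟩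
      · obtain ⟨j₀, hj₀⟩ := Finite.exists_min fun j => |νlim j - Mo.changePoint k|
        exact ⟨_, hpos j₀, hj₀⟩
    have h1 := hφ.tendsto_atTop.eventually (hω (d / 2) (by linarith))
    have h2 := eventually_all.2 fun j =>
      Metric.tendsto_nhds.1 (hlim j) (d / 2) (by linarith)
    obtain ⟨n, hn1, hn2⟩ := (h1.and h2).exists
    obtain ⟨j, hj⟩ := hn1 k
    have hj2 := hn2 (Fin.cast (hK n) j)
    rw [Real.dist_eq, abs_sub_comm] at hj2
    have := hd (Fin.cast (hK n) j)
    have htri := abs_sub_le (νlim (Fin.cast (hK n) j)) ((est (φ n) ω).changePoint j)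
      (Mo.changePoint k)
    simp only [Fin.cast_cast, Fin.cast_eq_self] at hj2
    linarith
  · filter_upwards [hlln, hest', hint] with ω hω hω' hint δ hδ
    -- A fitted interval is longer than `ε` and starts less than this amount before the true one;
    -- the bound `ε / 2` leaves the overlap required for oversegmentation.
    have hδ' : 0 < min δ (ε / 2) := lt_min hδ (by linarith)
    have hδε : min δ (ε / 2) ≤ ε / 2 := min_le_right _ _
    have hδδ : min δ (ε / 2) ≤ δ := min_le_left _ _
    filter_upwards [hint _ hδ' (by linarith), eventually_ge_atTop 1,
      eventually_oversegments_of_overlap hnw hΘ_compact hΘ_pos hε hMo hregions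
        (x := fun k s i w => X k s i w ω) hω hδ' (by linarith)] with T hT hT1 hover j
    obtain ⟨k, hk1, hk2, hk3⟩ := hMo.exists_interval_near (hω' T hT1).1 hε hδ' (by linarith) j
      (hT j)
    have hj := (hω' T hT1).1.2.2.2.1 j
    exact ⟨k, by linarith, by linarith, hover _ (hω' T hT1) j k hk3 (by linarith)⟩
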